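/- Let $\mathcal{G}=(\mathcal{V},\mathcal{E})$ be a directed graph on $\mathcal{V}=\{1,\dots,N\}$ in which every node has a self-loop, and put $\mathcal{N}_i=\{j \mid (j,i)\in\mathcal{E}\}$. Let $l(j,i)\in\{0,1,2,\dots\}\cup\{\infty\}$ be the length of a shortest directed path from $j$ to $i$, with $l(i,i)=0$ and $l(j,i)=\infty$ if there is no path. Let $m=\sum_i m_i$ and $p=\sum_i p_i$, and let $\mathcal{RH}_\infty^{m\times p}$ be the set of $m\times p$ matrices of real rational functions of $\mathrm z$ that are proper and have all their poles in $|\mathrm z|<1$. A transfer matrix $\mathbf{Q}$ of size $m\times p$, with blocks $\mathbf{Q}^{[i,j]}$ of size $m_i\times p_j$, is network-structured on $\mathcal{G}$, written $\mathbf{Q}\in\mathrm{NS}(\mathcal{G})$, if for some local state dimensions $n_1,\dots,n_N$ it is the transfer matrix $C(\mathrm zI-A)^{-1}B+D$ of a real system of the form $$\xi^{[i]}_{t+1}=\sum_{j\in\mathcal{N}_i}A^{[i,j]}\xi^{[j]}_t+B^{[i,i]}y^{[i]}_t,\qquad u^{[i]}_t=\sum_{j\in\mathcal{N}_i}C^{[i,j]}\xi^{[j]}_t+D^{[i,i]}y^{[i]}_t,\qquad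 i=1,\dots,N,$$ with $\xi^{[i]}_t\in\mathbb{R}^{n_i}$, $y^{[i]}_t\in\mathbb{R}^{p_i}$, $u^{[i]}_t\in\mathbb{R}^{m_i}$. Put $\mathrm{NS}(\mathcal{G})_{\mathrm{stab}}=\mathcal{RH}_\infty^{m\times p}\cap\mathrm{NS}(\mathcal{G})$. Let $\mathbf{Q}\in\mathcal{RH}_\infty^{m\times p}$. Then $\mathbf{Q}$ has a unique impulse-response expansion $\mathbf{Q}(\mathrm z)=\sum_{t=0}^\infty Q_t\,\mathrm z^{-t}$ for all complex $\mathrm z$ with $|\mathrm z|\ge 1$, with $Q_t\in\mathbb{R}^{m\times p}$, and $\mathbf{Q}\in\mathrm{NS}(\mathcal{G})_{\mathrm{stab}}$ if and only if, for all $i,j=1,\dots,N$, $$Q_{ijt}=0\quad\text{for all integers } t \text{ with } 0\le t<l(j,i),$$ where $Q_{ijt}\in\mathbb{R}^{m_i\times p_j}$ is the $(i,j)$ block of $Q_t$. -/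

import Mathlib

open Polynomial

noncomputable section

namespace NetSys

/-- Index set of a vector `vec(x^[1], …, x^[N])` whose `i`-th subvector has `d i` entries. -/
abbrev Idx {N : ℕ} (d : Fin N → ℕ) : Type := Σ i : Fin N, Fin (d i)

/-- The `(i, j)` block `M^[i,j]` of a block-partitioned matrix. -/
def block {N : ℕ} {r c : Fin N → ℕ} {R : Type*} (M : Matrix (Idx r) (Idx c) R)
    (i j : Fin N) : Matrix (Fin (r i)) (Fin (c j)) R :=
  Matrix.of fun a b => M ⟨i, a⟩ ⟨j, b⟩

/-- The shortest-path length `l(j, i)` from node `j` to node `i` along directed edges: the infimum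
of the lengths `k` of directed walks `j = v 0 → v 1 → ⋯ → v k = i`. It is `⊤` if there is none. -/
def pathLength {N : ℕ} (G : Digraph (Fin N)) (j i : Fin N) : ℕ∞ :=
  sInf {l : ℕ∞ | ∃ (k : ℕ) (v : ℕ → Fin N), l = (k : ℕ∞) ∧ v 0 = j ∧ v k = i ∧
    ∀ s < k, G.Adj (v s) (v (s + 1))}

/-- A finite-dimensional linear time-invariant system
`ξ_{t+1} = A ξ_t + B y_t`, `u_t = C ξ_t + D y_t`, partitioned over `N` nodes. Node `i` holds
`n i` states, `p i` inputs (entries of `y`) and `m i` outputs (entries of `u`). -/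
structure StateSpace {N : ℕ} (n m p : Fin N → ℕ) where
  A : Matrix (Idx n) (Idx n) ℝ
  B : Matrix (Idx n) (Idx p) ℝ
  C : Matrix (Idx m) (Idx n) ℝ
  D : Matrix (Idx m) (Idx p) ℝ

/-- The system has the form
`ξ^[i]_{t+1} = ∑_{j ∈ N_i} A^[i,j] ξ^[j]_t + B^[i,i] y^[i]_t`,
`u^[i]_t = ∑_{j ∈ N_i} C^[i,j] ξ^[j]_t + D^[i,i] y^[i]_t`,
where `N_i = {j | (j, i) is an edge}`. -/
def StateSpace.IsNetworkStructured {N : ℕ} {n m p : Fin N → ℕ} (S : StateSpace n m p)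
    (G : Digraph (Fin N)) : Prop :=
  (∀ i j, ¬ G.Adj j i → block S.A i j = 0) ∧
  (∀ i j, i ≠ j → block S.B i j = 0) ∧
  (∀ i j, ¬ G.Adj j i → block S.C i j = 0) ∧
  (∀ i j, i ≠ j → block S.D i j = 0)

/-- The transfer matrix `C (z I - A)⁻¹ B + D`, over the field of real rational functions in `z`. -/
def StateSpace.transfer {N : ℕ} {n m p : Fin N → ℕ} (S : StateSpace n m p) :
    Matrix (Idx m) (Idx p) (RatFunc ℝ) :=
  S.C.map RatFunc.C *
      ((RatFunc.X : RatFunc ℝ) • (1 : Matrix (Idx n) (Idx n) (RatFunc ℝ))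
        - S.A.map RatFunc.C)⁻¹ *
      S.B.map RatFunc.C
    + S.D.map RatFunc.C

/-- The network-structured transfer matrices on `G`: those that are the transfer matrix of some
network-structured system on `G`, with local state dimensions of any finite size. -/
def NS {N : ℕ} (m p : Fin N → ℕ) (G : Digraph (Fin N)) :
    Set (Matrix (Idx m) (Idx p) (RatFunc ℝ)) :=
  {Q | ∃ (n : Fin N → ℕ) (S : StateSpace n m p), S.IsNetworkStructured G ∧ S.transfer = Q}

/-- Real-rational proper stable transfer matrices: in every entry, in lowest terms, the degree of
the numerator is at most that of the denominator, and all complex poles lie in `|z| < 1`. -/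
def RHInf {ι κ : Type*} : Set (Matrix ι κ (RatFunc ℝ)) :=
  {Q | ∀ a b, (Q a b).num.natDegree ≤ (Q a b).denom.natDegree ∧
    ∀ z : ℂ, aeval z (Q a b).denom = 0 → ‖z‖ < 1}

/-- The stable network-structured transfer matrices on `G`. -/
def NSstab {N : ℕ} (m p : Fin N → ℕ) (G : Digraph (Fin N)) :
    Set (Matrix (Idx m) (Idx p) (RatFunc ℝ)) :=
  RHInf ∩ NS m p G

/-- The real matrices `q t` are the coefficients of the impulse-response expansion
`Q(z) = ∑_{t ≥ 0} q t z^{-t}`, for all complex `z` with `|z| ≥ 1`. -/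
def IsImpulseResponse {ι κ : Type*} (Q : Matrix ι κ (RatFunc ℝ)) (q : ℕ → Matrix ι κ ℝ) : Prop :=
  ∀ z : ℂ, 1 ≤ ‖z‖ → ∀ a b,
    HasSum (fun t : ℕ => (q t a b : ℂ) * (z ^ t)⁻¹) ((Q a b).eval (algebraMap ℝ ℂ) z)

end NetSys

end

noncomputable section

namespace NetSys

/-! ### Absolutely summable power series -/

/-! Everything reduces to relative degree (denominator degree minus numerator degree). In w = 1/z, a
stable entry is the quotient of its reflected numerator by its reversed denominator, whose constant
term is 1. The denominator is thus a unit among power series, and its inverse is a product of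
geometric series, absolutely summable as all poles lie in the open disc. This gives existence and
uniqueness of the expansion, and its first L coefficients vanish exactly when the entry is zero or
has relative degree at least L (`HasExpansion.forall_lt_eq_zero_iff`).

Necessity: the state transfer X = (zI - A)⁻¹B solves zX = AX + B and is strictly proper, so each
edge between input and state costs one factor 1/z (`infVal_le_of_mem_NS`).

Sufficiency: let d be a monic common denominator. For every input b at j and every k < deg d, node i
stores z^k / (d z^l(j,i)). Shifting a stored signal away from the source yields one stored by the
predecessor on a shortest path; at the source, the self-loop and the local input suffice. An output
P/d with deg P + l(j,i) ≤ deg d is then read off one edge (`mem_NS_of_infVal_le`). -/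

/-- A complex power series whose coefficients are absolutely summable. -/
def NormSummable (c : PowerSeries ℂ) : Prop := Summable fun t => ‖c.coeff t‖

theorem NormSummable.mul {c d : PowerSeries ℂ} (hc : NormSummable c) (hd : NormSummable d) :
    NormSummable (c * d) := by
  simpa only [NormSummable, PowerSeries.coeff_mul] using
    summable_norm_sum_mul_antidiagonal_of_summable_norm hc hd

theorem NormSummable.sub {c d : PowerSeries ℂ} (hc : NormSummable c) (hd : NormSummable d) :
    NormSummable (c - d) := by
  refine Summable.of_nonneg_of_le (fun _ => norm_nonneg _) (fun t => ?_) (hc.add hd)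
  rw [map_sub]
  exact norm_sub_le _ _

theorem normSummable_coe (P : ℂ[X]) : NormSummable (P : PowerSeries ℂ) := by
  refine summable_of_ne_finset_zero (s := P.support) fun t ht => ?_
  rw [Polynomial.coeff_coe, Polynomial.notMem_support_iff.mp ht, norm_zero]

theorem hasSum_coe (P : ℂ[X]) (w : ℂ) :
    HasSum (fun t => (P : PowerSeries ℂ).coeff t * w ^ t) (P.eval w) := by
  rw [Polynomial.eval_eq_sum, Polynomial.sum]
  simp only [Polynomial.coeff_coe]
  refine hasSum_sum_of_ne_finset_zero fun t ht => ?_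
  rw [Polynomial.notMem_support_iff.mp ht, zero_mul]

theorem NormSummable.summable_norm_mul_pow {c : PowerSeries ℂ} (hc : NormSummable c) {w : ℂ}
    (hw : ‖w‖ ≤ 1) : Summable fun t => ‖c.coeff t * w ^ t‖ := by
  refine Summable.of_nonneg_of_le (fun _ => norm_nonneg _) (fun t => ?_) hc
  rw [norm_mul, norm_pow]
  exact mul_le_of_le_one_right (norm_nonneg _) (pow_le_one₀ (norm_nonneg _) hw)

theorem NormSummable.hasSum_mul {c d : PowerSeries ℂ} (hc : NormSummable c) (hd : NormSummable d)
    {w x y : ℂ} (hw : ‖w‖ ≤ 1) (hx : HasSum (fun t => c.coeff t * w ^ t) x)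
    (hy : HasSum (fun t => d.coeff t * w ^ t) y) :
    HasSum (fun t => (c * d).coeff t * w ^ t) (x * y) := by
  have hs := ((hc.mul hd).summable_norm_mul_pow hw).of_norm.hasSum
  suffices hxy : x * y = ∑' t, (c * d).coeff t * w ^ t by rwa [hxy]
  rw [← hx.tsum_eq, ← hy.tsum_eq, tsum_mul_tsum_eq_tsum_sum_antidiagonal_of_summable_norm
    (hc.summable_norm_mul_pow hw) (hd.summable_norm_mul_pow hw)]
  refine tsum_congr fun t => ?_
  rw [PowerSeries.coeff_mul, Finset.sum_mul]
  refine Finset.sum_congr rfl fun k hk => ?_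
  rw [← Finset.HasAntidiagonal.mem_antidiagonal.mp hk, pow_add]
  ring

/-- A power series that sums to zero on the punctured closed unit disc is zero. -/
theorem eq_zero_of_hasSum_zero {c : PowerSeries ℂ}
    (h : ∀ w : ℂ, w ≠ 0 → ‖w‖ ≤ 1 → HasSum (fun t => c.coeff t * w ^ t) 0) : c = 0 := by
  -- Nothing is assumed at w = 0, so the series is multiplied by w, which makes the value there zero
  -- automatically.
  set p : ℕ → ℂ := fun t => (PowerSeries.X * c).coeff t with hp
  have hser : HasFPowerSeriesAt (0 : ℂ → ℂ) (FormalMultilinearSeries.ofScalars ℂ p) 0 := by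
    rw [hasFPowerSeriesAt_iff]
    filter_upwards [Metric.closedBall_mem_nhds (0 : ℂ) one_pos] with w hw
    simp only [FormalMultilinearSeries.coeff_ofScalars, Pi.zero_apply, smul_eq_mul]
    rw [← hasSum_nat_add_iff' 1]
    simp only [Finset.range_one, Finset.sum_singleton, hp, PowerSeries.coeff_zero_X_mul,
      PowerSeries.coeff_succ_X_mul, mul_zero, sub_zero]
    rcases eq_or_ne w 0 with rfl | hw0
    · simp
    · have := (h w hw0 (by simpa using hw)).mul_left w
      rw [mul_zero] at this
      exact this.congr_fun fun t => by ring
  have hz := hser.eq_zero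
  ext t
  have := congrArg (fun f => FormalMultilinearSeries.coeff f (t + 1)) hz
  simp only [FormalMultilinearSeries.coeff_ofScalars, hp, PowerSeries.coeff_succ_X_mul] at this
  rw [this, map_zero]
  rfl

/-- The reverse of a polynomial with all roots in the open unit disc has an absolutely summable
reciprocal. -/
theorem exists_normSummable_mul_reverse_prod (s : Multiset ℂ) (hs : ∀ a ∈ s, ‖a‖ < 1) :
    ∃ c : PowerSeries ℂ, NormSummable c ∧
      c * ((s.map fun a => X - C a).prod.reverse : ℂ[X]) = 1 := by
  induction s using Multiset.induction_on with
  | empty =>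
    refine ⟨((1 : ℂ[X]) : PowerSeries ℂ), normSummable_coe 1, ?_⟩
    rw [Multiset.map_zero, Multiset.prod_zero, ← Polynomial.C_1, Polynomial.reverse_C]
    simp
  | cons a s ih =>
    obtain ⟨c, hc, hcs⟩ := ih fun b hb => hs b (Multiset.mem_cons_of_mem hb)
    have ha := hs a (Multiset.mem_cons_self a s)
    -- The factor X - a reverses to 1 - aX, whose inverse is the geometric series.
    refine ⟨PowerSeries.mk (fun t => a ^ t) * c, NormSummable.mul ?_ hc, ?_⟩
    · simpa [NormSummable] using summable_geometric_of_lt_one (norm_nonneg a) ha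
    · have hrev : (X - C a : ℂ[X]).reverse = 1 - C a * X := by
        rw [Polynomial.reverse, natDegree_X_sub_C, Polynomial.reflect_sub, Polynomial.reflect_C]
        have := Polynomial.reflect_monomial (R := ℂ) 1 1
        rw [pow_one] at this
        simp [this]
      have hgeo : PowerSeries.mk (fun t => a ^ t) * ((1 - C a * X : ℂ[X]) : PowerSeries ℂ) = 1 := by
        ext t
        simp only [Polynomial.coe_sub, Polynomial.coe_one, Polynomial.coe_mul, Polynomial.coe_C,
          Polynomial.coe_X, mul_sub, mul_one, map_sub]
        rw [← mul_assoc]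
        cases t with
        | zero => simp
        | succ t =>
          rw [PowerSeries.coeff_succ_mul_X, PowerSeries.coeff_mul_C]
          simp [PowerSeries.coeff_one, pow_succ]
      rw [Multiset.map_cons, Multiset.prod_cons, Polynomial.reverse_mul_of_domain, hrev,
        Polynomial.coe_mul]
      calc _ = PowerSeries.mk (fun t => a ^ t) * ((1 - C a * X : ℂ[X]) : PowerSeries ℂ) *
            (c * ((s.map fun a => X - C a).prod.reverse : ℂ[X])) := by ring
        _ = 1 := by rw [hgeo, hcs, one_mul]

/-! ### Impulse responses of scalar stable transfer functions -/

/-- A proper rational function with all complex poles in the open unit disc. -/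
def IsStable (f : RatFunc ℝ) : Prop :=
  f.num.natDegree ≤ f.denom.natDegree ∧ ∀ z : ℂ, aeval z f.denom = 0 → ‖z‖ < 1

/-- The expansion `f(z) = ∑ q t z^{-t}` holds outside the open unit disc. -/
def HasExpansion (f : RatFunc ℝ) (q : ℕ → ℝ) : Prop :=
  ∀ z : ℂ, 1 ≤ ‖z‖ → HasSum (fun t : ℕ => (q t : ℂ) * (z ^ t)⁻¹) (f.eval (algebraMap ℝ ℂ) z)

/-- The numerator of `f`, as a power series in `z⁻¹` after multiplication by
`z ^ (-deg denom)`. -/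
def revNum (f : RatFunc ℝ) : PowerSeries ℝ := (reflect f.denom.natDegree f.num : ℝ[X])

/-- The reversed denominator of `f`, as a power series in `z⁻¹`. -/
def revDenom (f : RatFunc ℝ) : PowerSeries ℝ := (f.denom.reverse : ℝ[X])

theorem isUnit_revDenom (f : RatFunc ℝ) : IsUnit (revDenom f) := by
  rw [PowerSeries.isUnit_iff_constantCoeff, ← PowerSeries.coeff_zero_eq_constantCoeff_apply,
    revDenom, Polynomial.coeff_coe, coeff_zero_reverse, f.monic_denom.leadingCoeff]
  exact isUnit_one

/-- The reflected polynomial evaluated at 1/z is P(z) / z^n. -/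
theorem hasSum_map_reflect (P : ℝ[X]) {n : ℕ} (hP : P.natDegree ≤ n) {z : ℂ} (hz : z ≠ 0) :
    HasSum (fun t => (PowerSeries.map (algebraMap ℝ ℂ) (reflect n P : ℝ[X])).coeff t * z⁻¹ ^ t)
      (aeval z P * (z ^ n)⁻¹) := by
  have h := hasSum_coe ((reflect n P).map (algebraMap ℝ ℂ)) z⁻¹
  let : Invertible z := invertibleOfNonzero hz
  have he := Polynomial.eval₂_reflect_mul_pow (algebraMap ℝ ℂ) z n P hP
  rw [Polynomial.eval_map] at h
  rw [Polynomial.aeval_def, ← he, mul_assoc, mul_inv_cancel₀ (pow_ne_zero _ hz), mul_one,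
    invOf_eq_inv]
  simpa using h

theorem normSummable_map_coe (P : ℝ[X]) :
    NormSummable (PowerSeries.map (algebraMap ℝ ℂ) (P : PowerSeries ℝ)) := by
  have := normSummable_coe (P.map (algebraMap ℝ ℂ))
  simpa [NormSummable] using this

theorem IsStable.aeval_denom_ne_zero {f : RatFunc ℝ} (hf : IsStable f) {z : ℂ} (hz : 1 ≤ ‖z‖) :
    aeval z f.denom ≠ 0 := fun h => (hf.2 z h).not_ge hz

theorem IsStable.exists_normSummable {f : RatFunc ℝ} (hf : IsStable f) :
    ∃ r : PowerSeries ℝ, r * revDenom f = revNum f ∧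
      NormSummable (PowerSeries.map (algebraMap ℝ ℂ) r) := by
  obtain ⟨u, hu⟩ := (isUnit_revDenom f).exists_left_inv
  refine ⟨revNum f * u, by rw [mul_assoc, hu, mul_one], ?_⟩
  rw [map_mul]
  refine (normSummable_map_coe _).mul ?_
  set g := f.denom.map (algebraMap ℝ ℂ) with hg
  have hgm : g.Monic := f.monic_denom.map _
  obtain ⟨c, hc, hcg⟩ := exists_normSummable_mul_reverse_prod g.roots fun a ha => by
    refine hf.2 a ?_
    have := (Polynomial.mem_roots'.mp ha).2
    rwa [Polynomial.IsRoot.def, hg, Polynomial.eval_map, ← Polynomial.aeval_def] at this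
  rw [← (IsAlgClosed.splits g).eq_prod_roots_of_monic hgm] at hcg
  have hmap : PowerSeries.map (algebraMap ℝ ℂ) (revDenom f) = (g.reverse : ℂ[X]) := by
    ext t
    simp [revDenom, hg, Polynomial.coeff_reverse]
  have hu' := congrArg (PowerSeries.map (algebraMap ℝ ℂ)) hu
  rw [map_mul, hmap, map_one] at hu'
  -- Inverses are unique, so the real inverse maps to the complex one built from the roots.
  have : PowerSeries.map (algebraMap ℝ ℂ) u = c := by
    calc _ = PowerSeries.map (algebraMap ℝ ℂ) u * (c * (g.reverse : ℂ[X])) := by rw [hcg, mul_one]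
      _ = c * (PowerSeries.map (algebraMap ℝ ℂ) u * (g.reverse : ℂ[X])) := by ring
      _ = c := by rw [hu', mul_one]
  rwa [this]

theorem ne_zero_of_one_le_norm {z : ℂ} (hz : 1 ≤ ‖z‖) : z ≠ 0 :=
  norm_pos_iff.mp (one_pos.trans_le hz)

theorem IsStable.exists_hasExpansion {f : RatFunc ℝ} (hf : IsStable f) :
    ∃ q, HasExpansion f q := by
  obtain ⟨r, hr, hsum⟩ := hf.exists_normSummable
  refine ⟨fun t => r.coeff t, fun z hz => ?_⟩
  have hz0 := ne_zero_of_one_le_norm hz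
  have hw : ‖z⁻¹‖ ≤ 1 := by rw [norm_inv]; exact inv_le_one_of_one_le₀ hz
  obtain ⟨x, hx⟩ := (hsum.summable_norm_mul_pow hw).of_norm
  have hd := hasSum_map_reflect f.denom le_rfl hz0
  have hm := hsum.hasSum_mul (normSummable_map_coe f.denom.reverse) hw hx hd
  change HasSum (fun t => (_ * PowerSeries.map (algebraMap ℝ ℂ) (revDenom f)).coeff t * _) _ at hm
  rw [← map_mul, hr] at hm
  have := hm.unique (hasSum_map_reflect f.num hf.1 hz0)
  rw [← mul_assoc, mul_left_inj' (inv_ne_zero (pow_ne_zero _ hz0))] at this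
  have hxe : x = f.eval (algebraMap ℝ ℂ) z := by
    rw [RatFunc.eval, ← Polynomial.aeval_def, ← Polynomial.aeval_def,
      eq_div_iff (hf.aeval_denom_ne_zero hz), this]
  rw [← hxe]
  simpa using hx

/-- Turns the analytic expansion into a formal identity, from which uniqueness and the vanishing
criterion follow algebraically. -/
theorem HasExpansion.mul_revDenom {f : RatFunc ℝ} (hf : IsStable f) {q : ℕ → ℝ}
    (hq : HasExpansion f q) : PowerSeries.mk q * revDenom f = revNum f := by
  have hsum : NormSummable (PowerSeries.map (algebraMap ℝ ℂ) (PowerSeries.mk q)) := by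
    -- Convergence at z = 1 is unconditional, hence absolute.
    have := (hq 1 (by simp)).summable.norm
    simpa [NormSummable] using this
  have hn : NormSummable (PowerSeries.map (algebraMap ℝ ℂ) (revNum f)) := normSummable_map_coe _
  have hd : NormSummable (PowerSeries.map (algebraMap ℝ ℂ) (revDenom f)) := normSummable_map_coe _
  have key : PowerSeries.map (algebraMap ℝ ℂ) (PowerSeries.mk q) *
      PowerSeries.map (algebraMap ℝ ℂ) (revDenom f) -
      PowerSeries.map (algebraMap ℝ ℂ) (revNum f) = 0 := by
    refine eq_zero_of_hasSum_zero fun w hw0 hw => ?_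
    have hz : 1 ≤ ‖w⁻¹‖ := by
      rw [norm_inv]; exact (one_le_inv₀ (norm_pos_iff.mpr hw0)).mpr hw
    have hqz := hq w⁻¹ hz
    have h1 := hasSum_map_reflect f.denom le_rfl (inv_ne_zero hw0)
    have h2 := hasSum_map_reflect f.num hf.1 (inv_ne_zero hw0)
    simp only [inv_inv] at h1 h2
    have hq' : HasSum (fun t => (PowerSeries.map (algebraMap ℝ ℂ) (PowerSeries.mk q)).coeff t
        * w ^ t) (f.eval (algebraMap ℝ ℂ) w⁻¹) := by
      simpa using hqz
    have h3 := (hsum.hasSum_mul hd hw hq' h1).sub h2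
    rw [RatFunc.eval, ← Polynomial.aeval_def, ← Polynomial.aeval_def, ← mul_assoc,
      div_mul_cancel₀ _ (hf.aeval_denom_ne_zero hz), sub_self] at h3
    refine h3.congr_fun fun t => ?_
    rw [map_sub, sub_mul]
    rfl
  rw [← map_mul, sub_eq_zero] at key
  exact PowerSeries.map_injective _ (algebraMap ℝ ℂ).injective key

theorem HasExpansion.unique {f : RatFunc ℝ} (hf : IsStable f) {q q' : ℕ → ℝ}
    (hq : HasExpansion f q) (hq' : HasExpansion f q') : q = q' := by
  have h : PowerSeries.mk q = PowerSeries.mk q' :=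
    (isUnit_revDenom f).mul_left_injective
      ((hq.mul_revDenom hf).trans (hq'.mul_revDenom hf).symm)
  funext t
  simpa using congrArg (PowerSeries.coeff t) h

/-- Multiplying by the unit `revDenom f` preserves the order of vanishing, so it can be read off
`revNum f`. Zero is listed apart because its `intDegree` is 0. -/
theorem HasExpansion.forall_lt_eq_zero_iff {f : RatFunc ℝ} (hf : IsStable f) {q : ℕ → ℝ}
    (hq : HasExpansion f q) (L : ℕ) :
    (∀ t < L, q t = 0) ↔ f = 0 ∨ f.intDegree ≤ -(L : ℤ) := by
  have h1 : (∀ t < L, q t = 0) ↔ PowerSeries.X ^ L ∣ PowerSeries.mk q := by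
    simp [PowerSeries.X_pow_dvd_iff]
  have hu := isUnit_revDenom f
  rw [h1, ← hu.dvd_mul_right, hq.mul_revDenom hf, PowerSeries.X_pow_dvd_iff, RatFunc.intDegree]
  simp only [revNum, Polynomial.coeff_coe, coeff_reflect]
  constructor
  · intro h
    by_contra! hcon
    obtain ⟨hf0, hdeg⟩ := hcon
    have hle := hf.1
    -- Reflection moves the leading coefficient of the numerator to this index.
    have := h (f.denom.natDegree - f.num.natDegree) (by omega)
    rw [revAt_le (by omega), Nat.sub_sub_self hle, Polynomial.coeff_natDegree,
      Polynomial.leadingCoeff_eq_zero, RatFunc.num_eq_zero_iff] at this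
    exact hf0 this
  · rintro (rfl | hdeg) t ht
    · simp
    · rw [revAt_le (by omega)]
      exact Polynomial.coeff_eq_zero_of_natDegree_lt (by omega)

/-! ### The degree valuation on rational functions -/

open Classical in
/-- The valuation at infinity on real rational functions, `exp (deg num - deg denom)`. -/
def infVal : Valuation (RatFunc ℝ) (WithZero (Multiplicative ℤ)) := RatFunc.inftyValuation ℝ

theorem infVal_le_exp_iff {f : RatFunc ℝ} {k : ℤ} :
    infVal f ≤ WithZero.exp k ↔ f = 0 ∨ f.intDegree ≤ k := by
  by_cases hf : f = 0
  · simp [hf]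
  · simp [infVal, RatFunc.inftyValuation_apply, RatFunc.inftyValuation_of_nonzero, hf]

theorem infVal_X : infVal RatFunc.X = WithZero.exp 1 := by
  classical exact RatFunc.inftyValuation.X ℝ

theorem infVal_C_le_one (c : ℝ) : infVal (RatFunc.C c) ≤ 1 := by
  rw [← WithZero.exp_zero, infVal_le_exp_iff]
  exact Or.inr (by simp)

theorem infVal_C_mul_le {c : ℝ} {f : RatFunc ℝ} {g : WithZero (Multiplicative ℤ)}
    (hf : infVal f ≤ g) : infVal (RatFunc.C c * f) ≤ g := by
  rw [map_mul]
  exact (mul_le_of_le_one_left' (infVal_C_le_one c)).trans hf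

theorem infVal_le_of_X_mul {f : RatFunc ℝ} {k : ℤ}
    (h : infVal (RatFunc.X * f) ≤ WithZero.exp k) : infVal f ≤ WithZero.exp (k - 1) := by
  rcases eq_or_ne f 0 with rfl | hf
  · simp
  · rw [infVal_le_exp_iff] at h ⊢
    have := h.resolve_left (mul_ne_zero RatFunc.X_ne_zero hf)
    rw [RatFunc.intDegree_mul RatFunc.X_ne_zero hf, RatFunc.intDegree_X] at this
    exact Or.inr (by omega)

/-! ### Shortest directed paths -/

section pathLength

variable {N : ℕ} (G : Digraph (Fin N))

theorem pathLength_self (j : Fin N) : pathLength G j j = 0 :=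
  nonpos_iff_eq_zero.mp <| sInf_le ⟨0, fun _ => j, by simp, rfl, rfl, by simp⟩

theorem exists_walk_of_pathLength_eq {j i : Fin N} {L : ℕ} (h : pathLength G j i = L) :
    ∃ v : ℕ → Fin N, v 0 = j ∧ v L = i ∧ ∀ s < L, G.Adj (v s) (v (s + 1)) := by
  have hne : {l : ℕ∞ | ∃ (k : ℕ) (v : ℕ → Fin N), l = (k : ℕ∞) ∧ v 0 = j ∧ v k = i ∧
      ∀ s < k, G.Adj (v s) (v (s + 1))}.Nonempty := by
    by_contra hemp
    rw [Set.not_nonempty_iff_eq_empty] at hemp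
    rw [pathLength, hemp, sInf_empty] at h
    exact ENat.top_ne_natCast L h
  obtain ⟨k, v, hk, h0, hi, hadj⟩ := csInf_mem hne
  have : k = L := by
    rw [← pathLength, h] at hk
    exact_mod_cast hk.symm
  subst this
  exact ⟨v, h0, hi, hadj⟩

theorem pathLength_le_add_one {j i' i : Fin N} (h : G.Adj i' i) :
    pathLength G j i ≤ pathLength G j i' + 1 := by
  cases hl : pathLength G j i' using ENat.recTopCoe with
  | top => simp
  | coe L =>
    obtain ⟨v, h0, hL, hadj⟩ := exists_walk_of_pathLength_eq G hl
    refine sInf_le ⟨L + 1, fun s => if s ≤ L then v s else i, by simp, by simpa using h0,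
      by simp, fun s hs => ?_⟩
    rcases Nat.lt_succ_iff_lt_or_eq.mp hs with hs | rfl
    · simpa [hs.le, Nat.succ_le_of_lt hs] using hadj s hs
    · simpa [hL] using h

theorem eq_of_pathLength_eq_zero {j i : Fin N} (h : pathLength G j i = 0) : j = i := by
  obtain ⟨v, h0, hi, -⟩ := exists_walk_of_pathLength_eq G (L := 0) (by simpa using h)
  exact h0.symm.trans hi

theorem exists_adj_pathLength_eq {j i : Fin N} {L : ℕ} (h : pathLength G j i = (L + 1 : ℕ)) :
    ∃ i', G.Adj i' i ∧ pathLength G j i' = L := by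
  obtain ⟨v, h0, hi, hadj⟩ := exists_walk_of_pathLength_eq G h
  have hlast : G.Adj (v L) i := hi ▸ hadj L L.lt_succ_self
  refine ⟨v L, hlast, le_antisymm ?_ ?_⟩
  · exact sInf_le ⟨L, v, rfl, h0, rfl, fun s hs => hadj s (hs.trans L.lt_succ_self)⟩
  · have := pathLength_le_add_one G (j := j) hlast
    rw [h, Nat.cast_add, Nat.cast_one] at this
    exact (ENat.add_le_add_iff_right ENat.one_ne_top).mp this

end pathLength

/-! ### The resolvent equation -/

section resolvent

variable {N : ℕ} {n m p : Fin N → ℕ}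

theorem isUnit_det_X_sub {ι : Type*} [Fintype ι] [DecidableEq ι] (A : Matrix ι ι ℝ) :
    IsUnit ((RatFunc.X : RatFunc ℝ) • (1 : Matrix ι ι (RatFunc ℝ)) - A.map RatFunc.C).det := by
  have h : (RatFunc.X : RatFunc ℝ) • (1 : Matrix ι ι (RatFunc ℝ)) - A.map RatFunc.C =
      (algebraMap ℝ[X] (RatFunc ℝ)).mapMatrix A.charmatrix := by
    ext i j
    by_cases hij : i = j
    · subst hij
      simp [Matrix.charmatrix_apply_eq]
    · simp [hij]
  rw [h, ← RingHom.map_det, isUnit_iff_ne_zero]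
  exact RatFunc.algebraMap_ne_zero A.charpoly_monic.ne_zero

/-- The state transfer matrix `(z I - A)⁻¹ B` is the unique solution of `z X = A X + B`. -/
theorem X_smul_eq_iff {ι κ : Type*} [Fintype ι] [DecidableEq ι] (A : Matrix ι ι ℝ)
    (B : Matrix ι κ ℝ) (X : Matrix ι κ (RatFunc ℝ)) :
    (RatFunc.X : RatFunc ℝ) • X = A.map RatFunc.C * X + B.map RatFunc.C ↔
      X = ((RatFunc.X : RatFunc ℝ) • (1 : Matrix ι ι (RatFunc ℝ)) - A.map RatFunc.C)⁻¹ *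
        B.map RatFunc.C := by
  have hu := isUnit_det_X_sub A
  set M := (RatFunc.X : RatFunc ℝ) • (1 : Matrix ι ι (RatFunc ℝ)) - A.map RatFunc.C with hM
  have h1 : M * X = (RatFunc.X : RatFunc ℝ) • X - A.map RatFunc.C * X := by
    rw [hM, Matrix.sub_mul, Matrix.smul_mul, Matrix.one_mul]
  rw [← sub_eq_iff_eq_add', ← h1]
  constructor
  · rintro h
    rw [← h, Matrix.nonsing_inv_mul_cancel_left _ _ hu]
  · rintro rfl
    rw [Matrix.mul_nonsing_inv_cancel_left _ _ hu]

/-- Entries of a solution of `z X = A X + B` are strictly proper. -/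
theorem infVal_le_of_X_smul_eq {ι κ : Type*} [Fintype ι] {A : Matrix ι ι ℝ} {B : Matrix ι κ ℝ}
    {X : Matrix ι κ (RatFunc ℝ)}
    (h : (RatFunc.X : RatFunc ℝ) • X = A.map RatFunc.C * X + B.map RatFunc.C) (s : ι) (b : κ) :
    infVal (X s b) ≤ WithZero.exp (-1) := by
  have : Nonempty ι := ⟨s⟩
  -- At a row of maximal valuation v, the equation gives v(z)·v ≤ max(v, 1). As v(z) > 1, a nonzero
  -- v cannot be at least 1.
  obtain ⟨s₀, hs₀⟩ := Finite.exists_max fun s => infVal (X s b)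
  refine (hs₀ s).trans ?_
  have hentry : RatFunc.X * X s₀ b = ∑ s', RatFunc.C (A s₀ s') * X s' b + RatFunc.C (B s₀ b) := by
    simpa [Matrix.mul_apply] using congrFun (congrFun h s₀) b
  have hmax : infVal (RatFunc.X * X s₀ b) ≤ max (infVal (X s₀ b)) 1 := by
    rw [hentry]
    exact (infVal.map_add _ _).trans (max_le_max
      (infVal.map_sum_le fun s' _ => infVal_C_mul_le (hs₀ s')) (infVal_C_le_one _))
  rcases eq_or_ne (X s₀ b) 0 with h0 | h0
  · simp [h0]
  rcases le_total (infVal (X s₀ b)) 1 with hle | hle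
  · rw [max_eq_right hle, ← WithZero.exp_zero] at hmax
    exact infVal_le_of_X_mul hmax
  · rw [max_eq_left hle, map_mul, infVal_X] at hmax
    have hpos : 0 < infVal (X s₀ b) := zero_lt_iff.mpr (infVal.ne_zero_iff.mpr h0)
    have : WithZero.exp (1 : ℤ) ≤ 1 := le_of_mul_le_mul_right (by simpa using hmax) hpos
    rw [← WithZero.exp_zero, WithZero.exp_le_exp] at this
    omega

end resolvent

/-! ### Degree bounds for network-structured transfer matrices -/

/-- Away from the source, zX is a combination of in-neighbour states, each at most one step closer;
dividing by z gains one degree. The extra -1 is strict properness. A natural lower bound k also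
covers infinite distance. -/
theorem StateSpace.IsNetworkStructured.infVal_state_le {N : ℕ} {n m p : Fin N → ℕ}
    {G : Digraph (Fin N)} {S : StateSpace n m p} (hS : S.IsNetworkStructured G)
    {X : Matrix (Idx n) (Idx p) (RatFunc ℝ)}
    (hX : (RatFunc.X : RatFunc ℝ) • X = S.A.map RatFunc.C * X + S.B.map RatFunc.C) (k : ℕ)
    (s : Idx n) (b : Idx p) (hk : (k : ℕ∞) ≤ pathLength G b.1 s.1) :
    infVal (X s b) ≤ WithZero.exp (-(k : ℤ) - 1) := by
  induction k generalizing s with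
  | zero => simpa using infVal_le_of_X_smul_eq hX s b
  | succ k ih =>
    have hentry : RatFunc.X * X s b =
        ∑ s', RatFunc.C (S.A s s') * X s' b + RatFunc.C (S.B s b) := by
      simpa [Matrix.mul_apply] using congrFun (congrFun hX s) b
    have hne : s.1 ≠ b.1 := by
      intro hsb
      rw [hsb, pathLength_self] at hk
      simp at hk
    have hB : S.B s b = 0 := congrFun (congrFun (hS.2.1 _ _ hne) s.2) b.2
    rw [hB, map_zero, add_zero] at hentry
    refine infVal_le_of_X_mul ?_
    rw [hentry]
    refine infVal.map_sum_le fun s' _ => ?_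
    by_cases hadj : G.Adj s'.1 s.1
    · refine infVal_C_mul_le ?_
      have := ih s' ?_
      · simpa [sub_eq_add_neg, add_comm] using this
      · have := hk.trans (pathLength_le_add_one G (j := b.1) hadj)
        rw [Nat.cast_add, Nat.cast_one] at this
        exact (ENat.add_le_add_iff_right ENat.one_ne_top).mp this
    · have hA : S.A s s' = 0 := congrFun (congrFun (hS.1 _ _ hadj) s.2) s'.2
      simp [hA]

theorem infVal_le_of_mem_NS {N : ℕ} {m p : Fin N → ℕ} {G : Digraph (Fin N)}
    {Q : Matrix (Idx m) (Idx p) (RatFunc ℝ)} (hQ : Q ∈ NS m p G) (r : Idx m) (b : Idx p) (L : ℕ)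
    (hL : ((L + 1 : ℕ) : ℕ∞) ≤ pathLength G b.1 r.1) :
    infVal (Q r b) ≤ WithZero.exp (-((L + 1 : ℕ) : ℤ)) := by
  obtain ⟨n, S, hS, rfl⟩ := hQ
  set X := ((RatFunc.X : RatFunc ℝ) • (1 : Matrix (Idx n) (Idx n) (RatFunc ℝ))
    - S.A.map RatFunc.C)⁻¹ * S.B.map RatFunc.C with hXdef
  have hX := (X_smul_eq_iff S.A S.B X).mpr hXdef
  have hT : S.transfer = S.C.map RatFunc.C * X + S.D.map RatFunc.C := by
    rw [StateSpace.transfer, hXdef, Matrix.mul_assoc]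
  have hne : r.1 ≠ b.1 := by
    intro hrb
    rw [hrb, pathLength_self] at hL
    simp at hL
  have hD : S.D r b = 0 := congrFun (congrFun (hS.2.2.2 _ _ hne) r.2) b.2
  rw [hT, Matrix.add_apply, Matrix.map_apply, hD, map_zero, add_zero, Matrix.mul_apply]
  refine infVal.map_sum_le fun s _ => ?_
  by_cases hadj : G.Adj s.1 r.1
  · refine infVal_C_mul_le ?_
    have := hS.infVal_state_le hX L s b ?_
    · simpa [sub_eq_add_neg, add_comm] using this
    · have := hL.trans (pathLength_le_add_one G (j := b.1) hadj)
      rw [Nat.cast_add, Nat.cast_one] at this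
      exact (ENat.add_le_add_iff_right ENat.one_ne_top).mp this
  · have hC : S.C r s = 0 := congrFun (congrFun (hS.2.2.1 _ _ hadj) r.2) s.2
    simp [hC]

/-! ### Realization from a shift-closed family of signals -/

/-- The row with the rational function `f` at the input `b` and zeros elsewhere. -/
def inputRow {N : ℕ} {p : Fin N → ℕ} (b : Idx p) : RatFunc ℝ →ₗ[ℝ] (Idx p → RatFunc ℝ) :=
  LinearMap.single ℝ (fun _ => RatFunc ℝ) b

theorem X_smul_inputRow {N : ℕ} {p : Fin N → ℕ} (b : Idx p) (f : RatFunc ℝ) :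
    (RatFunc.X : RatFunc ℝ) • inputRow b f = inputRow b (RatFunc.X * f) :=
  (Pi.single_smul (f := fun _ : Idx p => RatFunc ℝ) b (RatFunc.X : RatFunc ℝ) f).symm

theorem sum_inputRow {N : ℕ} {p : Fin N → ℕ} (h : Idx p → RatFunc ℝ) :
    ∑ b, inputRow b (h b) = h :=
  Finset.univ_sum_single h

section realization

variable {N : ℕ} {n m p : Fin N → ℕ} (G : Digraph (Fin N))

/-- The signals available at node `i`: the real span of the state rows `X s` held at the
in-neighbours of `i` and of the local inputs. -/
def nearSpan (X : Idx n → Idx p → RatFunc ℝ) (i : Fin N) : Submodule ℝ (Idx p → RatFunc ℝ) :=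
  Submodule.span ℝ
    ({h | ∃ s, G.Adj s.1 i ∧ X s = h} ∪ {h | ∃ b : Idx p, b.1 = i ∧ inputRow b 1 = h})

variable {G}

/-- The coefficients become rows of A and B, or of C and D, with the zeros that the network
structure demands. -/
theorem exists_coeff_of_mem_nearSpan {X : Idx n → Idx p → RatFunc ℝ} {i : Fin N}
    {h : Idx p → RatFunc ℝ} (hh : h ∈ nearSpan G X i) :
    ∃ (α : Idx n → ℝ) (β : Idx p → ℝ), (∀ s, ¬ G.Adj s.1 i → α s = 0) ∧
      (∀ b, i ≠ b.1 → β b = 0) ∧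
      ∀ b, h b = ∑ s, RatFunc.C (α s) * X s b + RatFunc.C (β b) := by
  classical
  refine Submodule.span_induction ?_ ?_ ?_ ?_ hh
  · rintro h (⟨s, hs, rfl⟩ | ⟨b, hb, rfl⟩)
    · refine ⟨Pi.single s 1, 0, fun s' hs' => ?_, fun _ _ => rfl, fun b => ?_⟩
      · exact Pi.single_eq_of_ne (fun hss => hs' (by rw [hss]; exact hs)) _
      · rw [Finset.sum_eq_single s]
        · simp
        · intro s' _ hs'
          simp [Pi.single_eq_of_ne hs']
        · simp
    · refine ⟨0, Pi.single b 1, fun _ _ => rfl, fun b' hb' => ?_, fun b' => ?_⟩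
      · exact Pi.single_eq_of_ne (fun hbb => hb' (by rw [hbb]; exact hb.symm)) _
      · rcases eq_or_ne b' b with rfl | hne
        · simp [inputRow]
        · simp [inputRow, Pi.single_eq_of_ne hne]
  · exact ⟨0, 0, fun _ _ => rfl, fun _ _ => rfl, by simp⟩
  · rintro h h' - - ⟨α, β, hα, hβ, hh⟩ ⟨α', β', hα', hβ', hh'⟩
    refine ⟨α + α', β + β', fun s hs => by simp [hα s hs, hα' s hs],
      fun b hb => by simp [hβ b hb, hβ' b hb], fun b => ?_⟩
    simp only [Pi.add_apply, hh, hh', map_add, add_mul, Finset.sum_add_distrib]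
    ring
  · rintro c h - ⟨α, β, hα, hβ, hh⟩
    refine ⟨c • α, c • β, fun s hs => by simp [hα s hs], fun b hb => by simp [hβ b hb],
      fun b => ?_⟩
    simp only [Pi.smul_apply, hh, smul_eq_mul, map_mul, RatFunc.smul_eq_C_mul, mul_add,
      Finset.mul_sum, mul_assoc]

/-- A transfer matrix is network-structured as soon as finitely many state rows, distributed over
the nodes, are closed under the shift through the available signals and generate its rows. -/
theorem mem_NS_of_nearSpan {Q : Matrix (Idx m) (Idx p) (RatFunc ℝ)}
    (X : Idx n → Idx p → RatFunc ℝ)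
    (hX : ∀ s, (RatFunc.X : RatFunc ℝ) • X s ∈ nearSpan G X s.1)
    (hQ : ∀ r, Q r ∈ nearSpan G X r.1) : Q ∈ NS m p G := by
  choose A B hA hB hAB using fun s => exists_coeff_of_mem_nearSpan (hX s)
  choose C D hC hD hCD using fun r => exists_coeff_of_mem_nearSpan (hQ r)
  refine ⟨n, ⟨Matrix.of A, Matrix.of B, Matrix.of C, Matrix.of D⟩, ⟨?_, ?_, ?_, ?_⟩, ?_⟩
  · intro i j hij
    ext a b
    exact hA _ _ hij
  · intro i j hij
    ext a b
    exact hB _ _ hij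
  · intro i j hij
    ext a b
    exact hC _ _ hij
  · intro i j hij
    ext a b
    exact hD _ _ hij
  · have hres := (X_smul_eq_iff (Matrix.of A) (Matrix.of B) (Matrix.of X)).mp (by
      ext s b
      simpa [Matrix.mul_apply] using hAB s b)
    rw [StateSpace.transfer, Matrix.mul_assoc]
    ext r b
    rw [hCD r b]
    dsimp only
    rw [← hres]
    simp [Matrix.mul_apply]

end realization

/-! ### Delay chains along shortest paths -/

section delayChain

variable {N : ℕ} {n m p : Fin N → ℕ} (G : Digraph (Fin N))

/-- The delayed modes `z ^ k / (d z ^ l(j, i))` of the input `b` at node `j`, as seen at node `i`;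
they vanish if `i` cannot be reached from `j`. -/
def delayedMode (d : ℝ[X]) (b : Idx p) (k : ℕ) (i : Fin N) : Idx p → RatFunc ℝ :=
  -- Without this case, `toNat` would send ⊤ to 0 and give unreachable nodes an undelayed mode.
  if pathLength G b.1 i = ⊤ then 0
  else inputRow b (RatFunc.X ^ k /
    (algebraMap ℝ[X] (RatFunc ℝ) d * RatFunc.X ^ (pathLength G b.1 i).toNat))

variable {G}

theorem inputRow_div_mem_nearSpan {ξ : Idx n → Idx p → RatFunc ℝ} {d : ℝ[X]}
    (hξ : ∀ i (b : Idx p), ∀ k < d.natDegree, ∃ a, ξ ⟨i, a⟩ = delayedMode G d b k i)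
    {i' i : Fin N} (hadj : G.Adj i' i) {b : Idx p} {L : ℕ} (hL : pathLength G b.1 i' = L)
    {P : ℝ[X]} (hP : P.natDegree < d.natDegree) :
    inputRow b (algebraMap ℝ[X] (RatFunc ℝ) P /
      (algebraMap ℝ[X] (RatFunc ℝ) d * RatFunc.X ^ L)) ∈ nearSpan G ξ i := by
  have hmode (k : ℕ) : delayedMode G d b k i' = inputRow b (RatFunc.X ^ k /
      (algebraMap ℝ[X] (RatFunc ℝ) d * RatFunc.X ^ L)) := by
    rw [delayedMode, hL, if_neg (ENat.natCast_ne_top L), ENat.toNat_natCast]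
  have hPsum := P.as_sum_range' d.natDegree hP
  have hsum : inputRow b (algebraMap ℝ[X] (RatFunc ℝ) P /
      (algebraMap ℝ[X] (RatFunc ℝ) d * RatFunc.X ^ L)) =
      ∑ k ∈ Finset.range d.natDegree, P.coeff k • delayedMode G d b k i' := by
    simp only [hmode, ← map_smul]
    rw [← map_sum]
    congr 1
    conv_lhs => rw [hPsum]
    rw [map_sum, Finset.sum_div]
    refine Finset.sum_congr rfl fun k _ => ?_
    rw [← C_mul_X_pow_eq_monomial, RatFunc.smul_eq_C_mul, map_mul, map_pow, RatFunc.algebraMap_X,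
      RatFunc.algebraMap_C, mul_div_assoc]
  rw [hsum]
  refine Submodule.sum_mem _ fun k hk => Submodule.smul_mem _ _ (Submodule.subset_span ?_)
  obtain ⟨a, ha⟩ := hξ i' b k (Finset.mem_range.mp hk)
  exact Or.inl ⟨_, hadj, ha⟩

theorem inputRow_proper_mem_nearSpan (hG : ∀ i, G.Adj i i) {ξ : Idx n → Idx p → RatFunc ℝ}
    {d : ℝ[X]} (hd : d.Monic)
    (hξ : ∀ i (b : Idx p), ∀ k < d.natDegree, ∃ a, ξ ⟨i, a⟩ = delayedMode G d b k i)
    (b : Idx p) {P : ℝ[X]} (hP : P.natDegree ≤ d.natDegree) :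
    inputRow b (algebraMap ℝ[X] (RatFunc ℝ) P / algebraMap ℝ[X] (RatFunc ℝ) d) ∈
      nearSpan G ξ b.1 := by
  have hd0 : algebraMap ℝ[X] (RatFunc ℝ) d ≠ 0 := RatFunc.algebraMap_ne_zero hd.ne_zero
  have hone : inputRow b 1 ∈ nearSpan G ξ b.1 := Submodule.subset_span (Or.inr ⟨b, rfl, rfl⟩)
  rcases Nat.eq_zero_or_pos d.natDegree with hd1 | hd1
  · rw [hd.natDegree_eq_zero.mp hd1, eq_C_of_natDegree_eq_zero (by omega : P.natDegree = 0), map_one,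
      div_one, RatFunc.algebraMap_C, ← mul_one (RatFunc.C _), ← RatFunc.smul_eq_C_mul, map_smul]
    exact Submodule.smul_mem _ _ hone
  -- The constant c is the feedthrough; removing it leaves a strictly proper remainder, a
  -- combination of the node's own modes.
  set c := P.coeff d.natDegree with hc
  set R := P - C c * d with hR
  have hRdeg : R.natDegree < d.natDegree := by
    rcases eq_or_ne R 0 with hR0 | hR0
    · rwa [hR0, natDegree_zero]
    rw [natDegree_lt_iff_degree_lt hR0, degree_lt_iff_coeff_zero]
    intro k hk
    rcases hk.eq_or_lt with rfl | hk
    · simp [hR, hc, hd.coeff_natDegree]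
    · simp [hR, coeff_eq_zero_of_natDegree_lt (hP.trans_lt hk), coeff_eq_zero_of_natDegree_lt hk]
  have hsplit : algebraMap ℝ[X] (RatFunc ℝ) P / algebraMap ℝ[X] (RatFunc ℝ) d =
      algebraMap ℝ[X] (RatFunc ℝ) R / (algebraMap ℝ[X] (RatFunc ℝ) d * RatFunc.X ^ 0) +
        c • 1 := by
    rw [hR, map_sub, map_mul, RatFunc.algebraMap_C, RatFunc.smul_eq_C_mul]
    field_simp
    ring
  rw [hsplit, map_add, map_smul]
  exact add_mem (inputRow_div_mem_nearSpan hξ (hG b.1) (by rw [pathLength_self]; rfl) hRdeg)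
    (Submodule.smul_mem _ _ hone)

theorem X_smul_delayedMode_mem_nearSpan (hG : ∀ i, G.Adj i i) {ξ : Idx n → Idx p → RatFunc ℝ}
    {d : ℝ[X]} (hd : d.Monic)
    (hξ : ∀ i (b : Idx p), ∀ k < d.natDegree, ∃ a, ξ ⟨i, a⟩ = delayedMode G d b k i)
    (b : Idx p) {k : ℕ} (hk : k < d.natDegree) (i : Fin N) :
    (RatFunc.X : RatFunc ℝ) • delayedMode G d b k i ∈ nearSpan G ξ i := by
  have hX0 : (RatFunc.X : RatFunc ℝ) ≠ 0 := RatFunc.X_ne_zero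
  cases hl : pathLength G b.1 i using ENat.recTopCoe with
  | top =>
    rw [delayedMode, if_pos hl, smul_zero]
    exact zero_mem _
  | coe L =>
    rw [delayedMode, hl, if_neg (ENat.natCast_ne_top L), ENat.toNat_natCast, X_smul_inputRow]
    cases L with
    | zero =>
      obtain rfl := eq_of_pathLength_eq_zero G (by simpa using hl)
      have := inputRow_proper_mem_nearSpan hG hd hξ b (P := X ^ (k + 1))
        (by rw [natDegree_X_pow]; exact hk)
      rw [map_pow, RatFunc.algebraMap_X] at this
      rwa [pow_zero, mul_one, ← mul_div_assoc, ← pow_succ']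
    | succ L =>
      obtain ⟨i', hadj, hi'⟩ := exists_adj_pathLength_eq G hl
      have := inputRow_div_mem_nearSpan hξ hadj hi' (P := X ^ k) (by rw [natDegree_X_pow]; exact hk)
      rw [map_pow, RatFunc.algebraMap_X] at this
      rwa [pow_succ', mul_left_comm, ← mul_div_assoc, mul_div_mul_left _ _ hX0]

theorem inputRow_mem_nearSpan (hG : ∀ i, G.Adj i i) {ξ : Idx n → Idx p → RatFunc ℝ}
    {d : ℝ[X]} (hd : d.Monic)
    (hξ : ∀ i (b : Idx p), ∀ k < d.natDegree, ∃ a, ξ ⟨i, a⟩ = delayedMode G d b k i)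
    (b : Idx p) {P : ℝ[X]} {i : Fin N}
    (hP : P ≠ 0 → ∀ L : ℕ, (L : ℕ∞) ≤ pathLength G b.1 i → P.natDegree + L ≤ d.natDegree) :
    inputRow b (algebraMap ℝ[X] (RatFunc ℝ) P / algebraMap ℝ[X] (RatFunc ℝ) d) ∈
      nearSpan G ξ i := by
  have hX0 : (RatFunc.X : RatFunc ℝ) ≠ 0 := RatFunc.X_ne_zero
  rcases eq_or_ne P 0 with rfl | hP0
  · simp
  specialize hP hP0
  cases hl : pathLength G b.1 i using ENat.recTopCoe with
  | top =>
    -- An unreachable node would force a nonzero P to satisfy an impossible degree bound.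
    have := hP (d.natDegree + 1) (by rw [hl]; exact le_top)
    omega
  | coe L =>
    have hdeg := hP L hl.ge
    cases L with
    | zero =>
      obtain rfl := eq_of_pathLength_eq_zero G (by simpa using hl)
      exact inputRow_proper_mem_nearSpan hG hd hξ b (by simpa using hdeg)
    | succ L =>
      -- The predecessor stores signals delayed by L; the numerator P z^L cancels that delay, and
      -- its degree stays below deg d.
      obtain ⟨i', hadj, hi'⟩ := exists_adj_pathLength_eq G hl
      have := inputRow_div_mem_nearSpan hξ hadj hi' (P := P * X ^ L) (by
        rw [natDegree_mul_X_pow _ hP0]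
        omega)
      rwa [map_mul, map_pow, RatFunc.algebraMap_X, mul_div_mul_right _ _ (pow_ne_zero L hX0)]
        at this

end delayChain

theorem exists_common_denom {ι κ : Type*} [Fintype ι] [Fintype κ] (Q : Matrix ι κ (RatFunc ℝ)) :
    ∃ d : ℝ[X], d.Monic ∧ ∀ r b, ∃ P : ℝ[X],
      algebraMap ℝ[X] (RatFunc ℝ) P = Q r b * algebraMap ℝ[X] (RatFunc ℝ) d := by
  refine ⟨∏ rb : ι × κ, (Q rb.1 rb.2).denom,
    monic_prod_of_monic _ _ fun rb _ => RatFunc.monic_denom _, fun r b => ?_⟩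
  obtain ⟨c, hc⟩ := Finset.dvd_prod_of_mem (fun rb : ι × κ => (Q rb.1 rb.2).denom)
    (Finset.mem_univ (r, b))
  have hden : algebraMap ℝ[X] (RatFunc ℝ) (Q r b).denom ≠ 0 :=
    RatFunc.algebraMap_ne_zero (RatFunc.denom_ne_zero _)
  refine ⟨(Q r b).num * c, ?_⟩
  rw [hc, map_mul, map_mul, ← mul_assoc]
  congr 1
  exact (div_eq_iff hden).mp (RatFunc.num_div_denom (Q r b))

/-- A transfer matrix each of whose entries has relative degree at least the corresponding path
length is network-structured. -/
theorem mem_NS_of_infVal_le {N : ℕ} {m p : Fin N → ℕ} {G : Digraph (Fin N)}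
    (hG : ∀ i, G.Adj i i) {Q : Matrix (Idx m) (Idx p) (RatFunc ℝ)}
    (hQ : ∀ r b (L : ℕ), (L : ℕ∞) ≤ pathLength G b.1 r.1 →
      infVal (Q r b) ≤ WithZero.exp (-(L : ℤ))) : Q ∈ NS m p G := by
  obtain ⟨d, hdm, hnum⟩ := exists_common_denom Q
  have hd0 : algebraMap ℝ[X] (RatFunc ℝ) d ≠ 0 := RatFunc.algebraMap_ne_zero hdm.ne_zero
  let e := Fintype.equivFin (Idx p × Fin d.natDegree)
  let ξ : Idx (fun _ : Fin N => Fintype.card (Idx p × Fin d.natDegree)) → Idx p → RatFunc ℝ :=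
    fun s => delayedMode G d (e.symm s.2).1 (e.symm s.2).2 s.1
  have hξ : ∀ i (b : Idx p), ∀ k < d.natDegree, ∃ a, ξ ⟨i, a⟩ = delayedMode G d b k i :=
    fun i b k hk => ⟨e (b, ⟨k, hk⟩), by simp [ξ]⟩
  refine mem_NS_of_nearSpan ξ
    (fun s => X_smul_delayedMode_mem_nearSpan hG hdm hξ _ (Fin.is_lt _) _) fun r => ?_
  rw [← sum_inputRow (Q r)]
  refine Submodule.sum_mem _ fun b _ => ?_
  obtain ⟨P, hP⟩ := hnum r b
  rw [← mul_div_cancel_right₀ (Q r b) hd0, ← hP]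
  refine inputRow_mem_nearSpan hG hdm hξ b fun hP0 L hL => ?_
  have hQ0 : Q r b ≠ 0 := by
    intro h0
    rw [h0, zero_mul] at hP
    exact RatFunc.algebraMap_ne_zero hP0 hP
  have hdeg := (infVal_le_exp_iff.mp (hQ r b L hL)).resolve_left hQ0
  have := congrArg RatFunc.intDegree hP
  rw [RatFunc.intDegree_mul hQ0 hd0, RatFunc.intDegree_polynomial,
    RatFunc.intDegree_polynomial] at this
  omega

end NetSys

end

theorem proposition1 {N : ℕ} (G : Digraph (Fin N)) (hG : ∀ i, G.Adj i i) (m p : Fin N → ℕ)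
    (Q : Matrix (NetSys.Idx m) (NetSys.Idx p) (RatFunc ℝ)) (hQ : Q ∈ NetSys.RHInf) :
    (∃! q : ℕ → Matrix (NetSys.Idx m) (NetSys.Idx p) ℝ, NetSys.IsImpulseResponse Q q) ∧
    ∀ q : ℕ → Matrix (NetSys.Idx m) (NetSys.Idx p) ℝ, NetSys.IsImpulseResponse Q q →
      (Q ∈ NetSys.NSstab m p G ↔
        ∀ (i j : Fin N) (t : ℕ), (t : ℕ∞) < NetSys.pathLength G j i →
          NetSys.block (q t) i j = 0) := by
  have hst : ∀ r b, NetSys.IsStable (Q r b) := hQ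
  have hexp : ∀ {q : ℕ → Matrix (NetSys.Idx m) (NetSys.Idx p) ℝ}, NetSys.IsImpulseResponse Q q →
      ∀ r b, NetSys.HasExpansion (Q r b) fun t => q t r b := fun h r b z hz => h z hz r b
  refine ⟨?_, fun q hq => ⟨fun hNS i j t ht => ?_, fun h => ⟨hQ, ?_⟩⟩⟩
  · choose q hq using fun r b => (hst r b).exists_hasExpansion
    have hresp : NetSys.IsImpulseResponse Q fun t => Matrix.of fun r b => q r b t :=
      fun z hz r b => hq r b z hz
    refine ⟨_, hresp, fun q' hq' => ?_⟩
    funext t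
    ext r b
    exact congrFun ((hexp hq' r b).unique (hst r b) (hexp hresp r b)) t
  · ext a b
    -- For integer t, t < l means t + 1 ≤ l, which is relative degree at least t + 1.
    refine ((hexp hq ⟨i, a⟩ ⟨j, b⟩).forall_lt_eq_zero_iff (hst _ _) (t + 1)).mpr
      (NetSys.infVal_le_exp_iff.mp (NetSys.infVal_le_of_mem_NS hNS.2 _ _ t ?_)) t t.lt_succ_self
    rw [Nat.cast_add, Nat.cast_one]
    exact Order.add_one_le_of_lt ht
  · refine NetSys.mem_NS_of_infVal_le hG fun r b L hL => NetSys.infVal_le_exp_iff.mpr ?_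
    refine ((hexp hq r b).forall_lt_eq_zero_iff (hst r b) L).mp fun t ht => ?_
    exact congrFun (congrFun (h r.1 b.1 t ((Nat.cast_lt.mpr ht).trans_le hL)) r.2) b.2
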